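/- For a finite simple graph $G$, an edge-ordering of $G$ is a total ordering of its edge set $E(G)$, and a monotone path is a path (no repeated vertices) that traverses its edges in increasing order; its length is its number of edges. The altitude $f(G)$ is the largest integer $k$ such that every edge-ordering of $G$ contains a monotone path of length $k$. Let $K_n$ be the complete graph on $n$ vertices and let $\lg$ denote the base-$2$ logarithm. Then $$f(K_n) \ge \left(\frac{1}{20} - o(1)\right)\left(\frac{n}{\lg n}\right)^{2/3} \qquad (n \to \infty);$$ that is, there is a function $\varepsilon(n)$ with $\varepsilon(n) \to 0$ as $n \to \infty$ such that $f(K_n) \ge \left(\frac{1}{20} - \varepsilon(n)\right)\left(\frac{n}{\lg n}\right)^{2/3}$ for all $n \ge 2$. -/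

import Mathlib

open Filter Topology

/-- A walk `p` in `G` traverses edges in (strictly) increasing order with respect to the
total ordering `o` of the edge set of `G`. -/
def SimpleGraph.Walk.IsIncreasing {V : Type*} {G : SimpleGraph V} (o : LinearOrder G.edgeSet)
    {u v : V} (p : G.Walk u v) : Prop :=
  p.edges.Pairwise fun e f =>
    ∃ (he : e ∈ G.edgeSet) (hf : f ∈ G.edgeSet), o.lt ⟨e, he⟩ ⟨f, hf⟩

/-- Under the edge-ordering `o`, the graph `G` contains a monotone path of length `k`:
a path with `k` edges (no repeated vertices) that traverses its edges in increasing order. -/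
def SimpleGraph.HasMonotonePath {V : Type*} (G : SimpleGraph V) (o : LinearOrder G.edgeSet)
    (k : ℕ) : Prop :=
  ∃ (u v : V) (p : G.Walk u v), p.IsPath ∧ p.IsIncreasing o ∧ p.length = k

/-- The altitude of `G`: the largest `k` such that every ordering of the edges of `G`
admits a monotone path of length `k`. -/
noncomputable def SimpleGraph.altitude {V : Type*} (G : SimpleGraph V) : ℕ :=
  sSup {k : ℕ | ∀ o : LinearOrder G.edgeSet, G.HasMonotonePath o k}

/-- On a finite nonempty vertex set the supremum defining the altitude is a maximum. -/
theorem SimpleGraph.altitude_isGreatest {V : Type*} [Finite V] [Nonempty V]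
    (G : SimpleGraph V) :
    IsGreatest {k : ℕ | ∀ o : LinearOrder G.edgeSet, G.HasMonotonePath o k} G.altitude := by
  classical
  have : Fintype V := Fintype.ofFinite V
  have hne : {k : ℕ | ∀ o : LinearOrder G.edgeSet, G.HasMonotonePath o k}.Nonempty := by
    obtain ⟨v⟩ := ‹Nonempty V›
    exact ⟨0, fun o => ⟨v, v, .nil, by simp, by simp [SimpleGraph.Walk.IsIncreasing], rfl⟩⟩
  have hbd : BddAbove {k : ℕ | ∀ o : LinearOrder G.edgeSet, G.HasMonotonePath o k} := by
    refine ⟨Fintype.card V, fun k hk => ?_⟩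
    obtain ⟨u, v, p, hp, -, rfl⟩ := hk (IsWellOrder.linearOrder WellOrderingRel)
    exact hp.length_lt.le
  exact ⟨Nat.sSup_mem hne hbd, fun k hk => le_csSup hbd hk⟩

/-! Peeling deletes at most one edge per vertex, so a graph with more than `h * n` edges survives
`h` peelings, and an edge surviving `S` extra peelings has `S` heavier edges at each end. Extending
a path greedily spends about its whole length in peelings per edge, which only gives order `√n`.
`IncPath.extend_block` does better. Consider the endpoints reachable from the current path by few
edges. Their number cannot double `L > lg n` times, so at some step the next reachable set is less
than twice as large, and the extending edges form a dense graph on it. That set avoids the old path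
except at its end, so greedy extension inside it is hindered only by recent vertices and gains `q`
edges. With `4 * q` blocks of `L * 16 * q ^ 2` peelings each, length `4 * q ^ 2` needs `64 * q ^ 3 *
L * n` edges; comparing with `n.choose 2` gives the exponent `2 / 3`. -/

section PeelDefs

variable {V α : Type*} [LinearOrder α]

/-- The edges of `E` which are not of maximum weight at either of their endpoints. -/
noncomputable def peel (w : Sym2 V → α) (E : Finset (Sym2 V)) : Finset (Sym2 V) :=
  open Classical in E.filter fun e => ∀ v ∈ e, ∃ f ∈ E, v ∈ f ∧ w e < w f

theorem mem_peel {w : Sym2 V → α} {E : Finset (Sym2 V)} {e : Sym2 V} :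
    e ∈ peel w E ↔ e ∈ E ∧ ∀ v ∈ e, ∃ f ∈ E, v ∈ f ∧ w e < w f := by
  classical
  simp [peel]

theorem peel_subset {w : Sym2 V → α} {E : Finset (Sym2 V)} : peel w E ⊆ E :=
  fun _ he => (mem_peel.1 he).1

theorem peel_iterate_add_subset {w : Sym2 V → α} {E : Finset (Sym2 V)} (a b : ℕ) :
    (peel w)^[a + b] E ⊆ (peel w)^[a] E := by
  induction b with
  | zero => exact subset_rfl
  | succ b ih =>
    rw [← add_assoc, Function.iterate_succ_apply']
    exact peel_subset.trans ih

theorem peel_iterate_subset_self {w : Sym2 V → α} {E : Finset (Sym2 V)} (a : ℕ) :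
    (peel w)^[a] E ⊆ E := by
  simpa using peel_iterate_add_subset (w := w) (E := E) 0 a

/-- `IncPath w E s v e l`: there is a path with edges in `E`, of increasing weights, with vertex
set `s`, last vertex `v`, last edge `e`, and length `l ≥ 1`. -/
inductive IncPath [DecidableEq V] (w : Sym2 V → α) (E : Finset (Sym2 V)) :
    Finset V → V → Sym2 V → ℕ → Prop
  | single {u v : V} (h : s(u, v) ∈ E) (hne : u ≠ v) : IncPath w E {u, v} v s(u, v) 1
  | snoc {s : Finset V} {v z : V} {e : Sym2 V} {l : ℕ} (p : IncPath w E s v e l)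
      (h : s(v, z) ∈ E) (hz : z ∉ s) (hlt : w e < w s(v, z)) :
      IncPath w E (insert z s) z s(v, z) (l + 1)

end PeelDefs

/-! ### Peeling, greedy extension and the block construction -/

section Peel

open Finset

variable {V α : Type*} [DecidableEq V] [LinearOrder α] {w : Sym2 V → α} {E : Finset (Sym2 V)}

/-- Charge each deleted edge to an endpoint at which it is heaviest; injectivity of the weights
means no vertex is charged twice. -/
theorem card_le_card_peel_add (hw : Set.InjOn w E) {W : Finset V}
    (hW : ∀ e ∈ E, ∀ v ∈ e, v ∈ W) : #E ≤ #(peel w E) + #W := by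
  classical
  have hcard : #(E \ peel w E) ≤ #W := by
    refine card_le_card_of_forall_subsingleton
      (fun e v => v ∈ e ∧ ∀ f ∈ E, v ∈ f → w f ≤ w e) (fun e he => ?_) ?_
    · rw [Finset.mem_sdiff, mem_peel] at he
      by_contra! hcon
      exact he.2 ⟨he.1, fun v hv => hcon v (hW e he.1 v hv) hv⟩
    · rintro v - e ⟨he, hve, hemax⟩ f ⟨hf, hvf, hfmax⟩
      have heE := (Finset.mem_sdiff.1 he).1
      have hfE := (Finset.mem_sdiff.1 hf).1
      exact hw heE hfE (le_antisymm (hfmax e heE hve) (hemax f hfE hvf))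
  have := card_sdiff_add_card_eq_card (peel_subset (w := w) (E := E))
  omega

theorem card_le_card_peel_iterate_add (hw : Set.InjOn w E) {W : Finset V}
    (hW : ∀ e ∈ E, ∀ v ∈ e, v ∈ W) (h : ℕ) : #E ≤ #((peel w)^[h] E) + h * #W := by
  induction h with
  | zero => simp
  | succ h ih =>
    have hsub := peel_iterate_subset_self (w := w) (E := E) h
    have := card_le_card_peel_add (hw.mono (coe_subset.2 hsub)) (fun e he => hW e (hsub he))
    rw [Function.iterate_succ_apply', add_mul, one_mul]
    omega

theorem peel_iterate_nonempty (hw : Set.InjOn w E) {W : Finset V}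
    (hW : ∀ e ∈ E, ∀ v ∈ e, v ∈ W) {h : ℕ} (hE : h * #W < #E) : ((peel w)^[h] E).Nonempty := by
  have := card_le_card_peel_iterate_add hw hW h
  exact card_pos.1 (by omega)

/-- An edge that survives many peelings has many heavier edges at each of its endpoints. -/
theorem le_card_heavier_edges {h S : ℕ} {e : Sym2 V} {v : V} (hv : v ∈ e)
    (he : e ∈ (peel w)^[h + S] E) : S ≤ #{f ∈ (peel w)^[h] E | v ∈ f ∧ w e < w f} := by
  induction S generalizing e with
  | zero => exact Nat.zero_le _
  | succ S ih =>
    rw [← add_assoc, Function.iterate_succ_apply', mem_peel] at he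
    obtain ⟨g, hg, hvg, hlt⟩ := he.2 v hv
    have hsub : insert g {f ∈ (peel w)^[h] E | v ∈ f ∧ w g < w f} ⊆
        {f ∈ (peel w)^[h] E | v ∈ f ∧ w e < w f} := by
      intro f hf
      rcases mem_insert.1 hf with rfl | hf
      · exact mem_filter.2 ⟨peel_iterate_add_subset h S hg, hvg, hlt⟩
      · obtain ⟨h1, h2, h3⟩ := mem_filter.1 hf
        exact mem_filter.2 ⟨h1, h2, hlt.trans h3⟩
    have := card_le_card hsub
    rw [card_insert_of_notMem (by simp)] at this
    have := ih hvg hg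
    omega

theorem le_card_heavier_neighbors [Fintype V] {h S : ℕ} {e : Sym2 V} {v : V} (hv : v ∈ e)
    (he : e ∈ (peel w)^[h + S] E) :
    S ≤ #{z : V | s(v, z) ∈ (peel w)^[h] E ∧ w e < w s(v, z)} := by
  classical
  refine (le_card_heavier_edges hv he).trans ?_
  refine (card_le_card ?_).trans
    (card_image_le (f := fun z => s(v, z)))
  intro f hf
  obtain ⟨h1, ⟨z, rfl⟩, h3⟩ := mem_filter.1 hf
  exact mem_image.2 ⟨z, by simp [h1, h3], rfl⟩

namespace IncPath

variable {s : Finset V} {v : V} {e : Sym2 V} {l : ℕ}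

theorem mem_edge (p : IncPath w E s v e l) : v ∈ e := by
  cases p <;> simp

theorem card_eq (p : IncPath w E s v e l) : #s = l + 1 := by
  induction p with
  | single h hne => exact card_pair hne
  | snoc p h hz hlt ih => rw [card_insert_of_notMem hz, ih]

theorem exists_length_eq (p : IncPath w E s v e l) {k : ℕ} (hk : 1 ≤ k) (hkl : k ≤ l) :
    ∃ s v e, IncPath w E s v e k := by
  induction p with
  | single h hne =>
    obtain rfl : k = 1 := le_antisymm hkl hk
    exact ⟨_, _, _, single h hne⟩
  | @snoc s v z e l p h hz hlt ih =>
    rcases hkl.lt_or_eq with hlt' | rfl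
    · exact ih (Nat.lt_succ_iff.1 hlt')
    · exact ⟨_, _, _, snoc p h hz hlt⟩

/-- Greedy extension of a path inside an edge set `H` spanned by `W`. -/
theorem extend_greedily [Fintype V] {H : Finset (Sym2 V)} (hHE : H ⊆ E) {W : Finset V}
    (hW : ∀ f ∈ H, ∀ z ∈ f, z ∈ W) {D : ℕ} (j : ℕ) (p : IncPath w E s v e l)
    (he : e ∈ (peel w)^[j * D] H) (hD : #(s ∩ W) + j ≤ D) :
    ∃ s' v' e', IncPath w E s' v' e' (l + j) ∧ e' ∈ H := by
  induction j generalizing s v e l with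
  | zero => exact ⟨s, v, e, p, by simpa using he⟩
  | succ j ih =>
    rw [add_mul, one_mul] at he
    have hcard := le_card_heavier_neighbors p.mem_edge he
    -- Edges of `H` stay in `W`, so only the path vertices in `W` can block one of the `D` heavier
    -- neighbours.
    obtain ⟨z, hz, hzs⟩ := exists_mem_notMem_of_card_lt_card
      (s := s ∩ W) (lt_of_lt_of_le (by omega) hcard)
    obtain ⟨hzH, hlt⟩ := (mem_filter.1 hz).2
    have hzH' := peel_iterate_subset_self _ hzH
    have hzW : z ∈ W := hW _ hzH' z (by simp)
    have hz' : z ∉ s := fun h => hzs (mem_inter.2 ⟨h, hzW⟩)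
    have hins : #(insert z s ∩ W) + j ≤ D := by
      rw [insert_inter_of_mem hzW]
      have := card_insert_le z (s ∩ W)
      omega
    obtain ⟨s', v', e', p', he'⟩ := ih (snoc p (hHE hzH') hz' hlt) hzH hins
    exact ⟨s', v', e', by rwa [add_right_comm, add_assoc] at p', he'⟩

end IncPath

/-- `y` is the end of an increasing path that extends a path with vertex set `s₀` and end `x`
by at most `i` edges, and whose last edge lies in `X`. -/
def ReachedBy (w : Sym2 V → α) (E X : Finset (Sym2 V)) (s₀ : Finset V) (x : V) (l₀ i : ℕ)
    (y : V) : Prop :=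
  (y = x ∨ y ∉ s₀) ∧
    ∃ s e l, IncPath w E s y e l ∧ e ∈ X ∧ s₀ ⊆ s ∧ l₀ ≤ l ∧ l ≤ l₀ + i

theorem exists_card_succ_lt_two_mul {R : ℕ → ℕ} {N L : ℕ} (h0 : 1 ≤ R 0) (hN : ∀ i, R i ≤ N)
    (hL : N < 2 ^ L) : ∃ i < L, R (i + 1) < 2 * R i := by
  by_contra! hcon
  have : ∀ i ≤ L, 2 ^ i ≤ R i := by
    intro i
    induction i with
    | zero => simpa using h0
    | succ i ih =>
      intro hi
      have := hcon i hi
      have := ih (by omega)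
      rw [pow_succ]
      omega
  have := this L le_rfl
  have := hN L
  omega

/-- If the sets reached from `R` are small, then the extending edges are dense. -/
theorem lt_card_edges_of_card_lt {R W : Finset V} {Z : V → Finset V} {c d : ℕ}
    {H : Finset (Sym2 V)} (hH : ∀ y ∈ R, ∀ z ∈ Z y, s(y, z) ∈ H)
    (hZ : ∀ y ∈ R, c ≤ #(Z y)) (hW : #W < 2 * #R) (hd : 0 < d) (hc : 4 * d ≤ c) :
    d * #W < #H := by
  classical
  have h1 : #R * c ≤ #(R.sigma Z) := by
    rw [card_sigma]
    simpa using card_nsmul_le_sum R (fun y => #(Z y)) c hZ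
  -- An edge arises from at most two ordered pairs, one per orientation.
  have h2 : #(R.sigma Z) ≤ 2 * #H := by
    let F : (Σ _ : V, V) → Sym2 V := fun p => s(p.1, p.2)
    refine (card_le_mul_card_image (f := F) (R.sigma Z) 2 ?_).trans
      (Nat.mul_le_mul_left 2 (card_le_card ?_))
    · intro a ha
      induction a with
      | _ a b =>
        refine (card_le_card (t := {⟨a, b⟩, ⟨b, a⟩}) ?_).trans card_le_two
        rintro ⟨p, q⟩ hp
        have := (mem_filter.1 hp).2
        rcases Sym2.eq_iff.1 this with ⟨rfl, rfl⟩ | ⟨rfl, rfl⟩ <;> simp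
    · intro f hf
      obtain ⟨p, hp, rfl⟩ := mem_image.1 hf
      obtain ⟨hp1, hp2⟩ := mem_sigma.1 hp
      exact hH _ hp1 _ hp2
  have h3 : #R * (4 * d) ≤ #R * c := Nat.mul_le_mul_left _ hc
  have h4 : d * #W < d * (2 * #R) := Nat.mul_lt_mul_of_pos_left hW hd
  nlinarith

/-- One round of the construction: `L * S` levels of peeling buy `q` further edges. -/
theorem IncPath.extend_block [Fintype V] (hw : Set.InjOn w E) {s₀ : Finset V} {x : V}
    {e₀ : Sym2 V} {l₀ h L S q : ℕ} (p₀ : IncPath w E s₀ x e₀ l₀)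
    (he₀ : e₀ ∈ (peel w)^[h + L * S] E) (hL : Fintype.card V < 2 ^ L) (hq : 0 < q)
    (hS : l₀ + 1 + L + 4 * (q * (L + q + 3)) ≤ S) :
    ∃ s x e l, IncPath w E s x e l ∧ e ∈ (peel w)^[h] E ∧ l₀ + q ≤ l := by
  classical
  -- Each further step gives up `S` levels of peeling, which supplies `S` heavier neighbours in the
  -- next `X`.
  let X : ℕ → Finset (Sym2 V) := fun i => (peel w)^[h + (L - i) * S] E
  let R : ℕ → Finset V := fun i => univ.filter (ReachedBy w E (X i) s₀ x l₀ i)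
  have hR0 : 1 ≤ #(R 0) := card_pos.2 ⟨x, mem_filter.2 ⟨mem_univ _, Or.inl rfl,
    s₀, e₀, l₀, p₀, by simpa [X] using he₀, subset_rfl, le_rfl, le_rfl⟩⟩
  obtain ⟨i, hiL, hi⟩ := exists_card_succ_lt_two_mul (R := fun i => #(R i)) hR0
    (fun i => card_le_univ _) hL
  have hX : X i = (peel w)^[(h + (L - (i + 1)) * S) + S] E := by
    have : L - i = L - (i + 1) + 1 := by omega
    simp only [X, this, add_mul, one_mul, add_assoc]
  have hX' : X i ⊆ X (i + 1) := by
    rw [hX]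
    exact peel_iterate_add_subset _ _
  have hXE : X (i + 1) ⊆ E := peel_iterate_subset_self _
  have hmem : ∀ y ∈ R i, ReachedBy w E (X i) s₀ x l₀ i y := fun y hy => (mem_filter.1 hy).2
  have : Nonempty (Sym2 V) := ⟨e₀⟩
  choose! hy s e l p heX hs hl hl' using hmem
  let Z : V → Finset V := fun y =>
    ({z : V | s(y, z) ∈ X (i + 1) ∧ w (e y) < w s(y, z)} : Finset V) \ s y
  have hZcard : ∀ y ∈ R i, 4 * (q * (L + q + 3)) ≤ #(Z y) := by
    intro y hyR
    have h1 := le_card_heavier_neighbors (p y hyR).mem_edge (hX ▸ heX y hyR)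
    have h2 := le_card_sdiff (s y)
      ({z : V | s(y, z) ∈ X (i + 1) ∧ w (e y) < w s(y, z)} : Finset V)
    have h3 := (p y hyR).card_eq
    have h4 := hl' y hyR
    have h5 : S ≤ #({z : V | s(y, z) ∈ X (i + 1) ∧ w (e y) < w s(y, z)} : Finset V) := h1
    simp only [Z]
    omega
  let H : Finset (Sym2 V) := (R i).biUnion fun y => (Z y).image fun z => s(y, z)
  have hZ : ∀ y, ∀ z ∈ Z y, s(y, z) ∈ X (i + 1) ∧ w (e y) < w s(y, z) ∧ z ∉ s y := by
    intro y z hz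
    obtain ⟨h1, h2⟩ := Finset.mem_sdiff.1 hz
    exact ⟨(mem_filter.1 h1).2.1, (mem_filter.1 h1).2.2, h2⟩
  have hHmem : ∀ f ∈ H, ∃ y ∈ R i, ∃ z ∈ Z y, s(y, z) = f := by
    intro f hf
    obtain ⟨y, hyR, hf⟩ := mem_biUnion.1 hf
    obtain ⟨z, hz, hf⟩ := mem_image.1 hf
    exact ⟨y, hyR, z, hz, hf⟩
  have hHX : H ⊆ X (i + 1) := by
    intro f hf
    obtain ⟨y, hyR, z, hz, rfl⟩ := hHmem f hf
    exact (hZ y z hz).1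
  have hsnoc : ∀ y ∈ R i, ∀ z ∈ Z y, IncPath w E (insert z (s y)) z s(y, z) (l y + 1) := by
    intro y hyR z hz
    obtain ⟨h1, h2, h3⟩ := hZ y z hz
    exact (p y hyR).snoc (hXE h1) h3 h2
  have hHW : ∀ f ∈ H, ∀ v ∈ f, v ∈ R (i + 1) := by
    intro f hf v hv
    obtain ⟨y, hyR, z, hz, rfl⟩ := hHmem f hf
    refine mem_filter.2 ⟨mem_univ _, ?_⟩
    rcases Sym2.mem_iff.1 hv with rfl | rfl
    · exact ⟨hy v hyR, s v, e v, l v, p v hyR, hX' (heX v hyR), hs v hyR, hl v hyR,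
        (hl' v hyR).trans (by omega)⟩
    · obtain ⟨h1, h2, h3⟩ := hZ y v hz
      have h4 := hl y hyR
      have h5 := hl' y hyR
      exact ⟨Or.inr fun h => h3 (hs y hyR h), insert v (s y), s(y, v), l y + 1,
        hsnoc y hyR v hz, h1, (hs y hyR).trans (subset_insert _ _), by omega, by omega⟩
  have hdense : q * (L + q + 3) * #(R (i + 1)) < #H :=
    lt_card_edges_of_card_lt (R := R i) (Z := Z)
      (fun y hyR z hz => mem_biUnion.2 ⟨y, hyR, mem_image_of_mem _ hz⟩) hZcard hi
      (by positivity) le_rfl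
  obtain ⟨f, hf⟩ := peel_iterate_nonempty (hw.mono (coe_subset.2 (hHX.trans hXE))) hHW hdense
  obtain ⟨y, hyR, z, hz, rfl⟩ := hHmem f (peel_iterate_subset_self _ hf)
  -- The bound does not involve `l₀`: apart from `x`, no vertex of `s₀` is in `R (i + 1)`.
  have hcap : #(insert z (s y) ∩ R (i + 1)) ≤ L + 3 := by
    have hsub : insert z (s y) ∩ R (i + 1) ⊆ insert z (insert x (s y \ s₀)) := by
      intro v hv
      obtain ⟨h1, h2⟩ := mem_inter.1 hv
      have h3 : v = x ∨ v ∉ s₀ := (mem_filter.1 h2).2.1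
      simp only [mem_insert, Finset.mem_sdiff] at h1 ⊢
      tauto
    have h1 := card_le_card hsub
    have h2 := card_insert_le z (insert x (s y \ s₀))
    have h3 := card_insert_le x (s y \ s₀)
    have h4 := card_sdiff_add_card_eq_card (hs y hyR)
    have h5 := (p y hyR).card_eq
    have h6 := p₀.card_eq
    have h7 := hl' y hyR
    omega
  obtain ⟨s', v', e', p', he'⟩ := (hsnoc y hyR z hz).extend_greedily (hHX.trans hXE) hHW q hf
    (by omega)
  refine ⟨s', v', e', _, p', peel_iterate_add_subset _ _ (hHX he'), ?_⟩
  have := hl y hyR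
  omega

/-- Stopping once the length reaches `k` keeps `l₀ + 1 ≤ k`, so one value of `S` serves every block.
-/
theorem IncPath.extend_blocks [Fintype V] (hw : Set.InjOn w E) {L S q k : ℕ}
    (hL : Fintype.card V < 2 ^ L) (hq : 0 < q)
    (hS : k + L + 4 * (q * (L + q + 3)) ≤ S) (b : ℕ) {s₀ : Finset V} {x : V}
    {e₀ : Sym2 V} {l₀ : ℕ} (p₀ : IncPath w E s₀ x e₀ l₀)
    (he₀ : e₀ ∈ (peel w)^[b * (L * S)] E) :
    ∃ s x e l, IncPath w E s x e l ∧ (k ≤ l ∨ l₀ + b * q ≤ l) := by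
  induction b generalizing s₀ x e₀ l₀ with
  | zero => exact ⟨_, _, _, _, p₀, Or.inr (by simp)⟩
  | succ b ih =>
    by_cases hk : k ≤ l₀
    · exact ⟨_, _, _, _, p₀, Or.inl hk⟩
    rw [add_mul, one_mul] at he₀
    obtain ⟨s, x, e, l, p, he, hl⟩ := p₀.extend_block hw he₀ hL hq (by omega)
    obtain ⟨s', x', e', l', p', h'⟩ := ih p he
    refine ⟨s', x', e', l', p', h'.imp_right fun h => ?_⟩
    rw [add_mul, one_mul]
    omega

/-- Every edge-weighted graph with enough edges has an increasing path with `4 * q ^ 2` edges. -/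
theorem exists_incPath_of_card_lt [Fintype V] (hw : Set.InjOn w E) (hE : ∀ e ∈ E, ¬ e.IsDiag)
    {L q : ℕ} (hL : Fintype.card V < 2 ^ L) (hq : 4 ≤ q) (hLq : L ≤ q)
    (hcard : 64 * q ^ 3 * L * Fintype.card V < #E) :
    ∃ s x e, IncPath w E s x e (4 * q ^ 2) := by
  obtain ⟨e, he⟩ := peel_iterate_nonempty (h := 4 * q * (L * (16 * q ^ 2))) hw (W := univ)
    (fun _ _ _ _ => mem_univ _) (by rw [card_univ]; convert hcard using 2; ring)
  have heE := peel_iterate_subset_self _ he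
  induction e with
  | _ u v =>
    have huv : u ≠ v := by simpa using hE _ heE
    -- With `L ≤ q` the requirement on `S` is at most `12 * q ^ 2 + 13 * q`, which is below `16 * q
    -- ^ 2` once `4 ≤ q`.
    obtain ⟨s, x, e, l, p, hl⟩ := (IncPath.single heE huv : IncPath w E _ _ _ _).extend_blocks hw
      (k := 4 * q ^ 2) (S := 16 * q ^ 2) (q := q) hL (by omega) (by nlinarith) (4 * q) he
    have hkl : 4 * q ^ 2 ≤ l := by
      rcases hl with hl | hl
      · exact hl
      · nlinarith
    exact p.exists_length_eq (by nlinarith) hkl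

end Peel

/-! ### From weighted graphs to the altitude -/

section Altitude

variable {V : Type*} {G : SimpleGraph V}

theorem exists_orderEmbedding_nat (β : Type*) [Finite β] [LinearOrder β] :
    ∃ r : β → ℕ, Function.Injective r ∧ ∀ a b, r a < r b → a < b := by
  have : Fintype β := Fintype.ofFinite β
  let φ := (monoEquivOfFin β rfl).symm
  exact ⟨fun b => φ b, Fin.val_injective.comp φ.injective, fun a b h => φ.lt_iff_lt.1 h⟩

/-- An ordering of the edges of a finite graph is given by injective weights. -/
theorem exists_edgeWeight [Finite V] (o : LinearOrder G.edgeSet) :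
    ∃ w : Sym2 V → ℕ, Set.InjOn w G.edgeSet ∧
      ∀ e f (he : e ∈ G.edgeSet) (hf : f ∈ G.edgeSet), w e < w f → o.lt ⟨e, he⟩ ⟨f, hf⟩ := by
  obtain ⟨r, hr, hlt⟩ := @exists_orderEmbedding_nat G.edgeSet _ o
  have hext : ∀ e (he : e ∈ G.edgeSet), Function.extend Subtype.val r 0 e = r ⟨e, he⟩ :=
    fun e he => Subtype.val_injective.extend_apply r 0 ⟨e, he⟩
  refine ⟨Function.extend Subtype.val r 0, fun e he f hf hef => ?_, fun e f he hf hef => ?_⟩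
  · rw [hext e he, hext f hf] at hef
    exact congrArg Subtype.val (hr hef)
  · rw [hext e he, hext f hf] at hef
    exact hlt _ _ hef

/-- The clauses on the support and on the heaviest edge are what the induction needs to append an
edge. -/
theorem IncPath.exists_walk [DecidableEq V] {α : Type*} [LinearOrder α] {w : Sym2 V → α}
    {E : Finset (Sym2 V)} (hE : ↑E ⊆ G.edgeSet) {s : Finset V} {v : V} {e : Sym2 V} {l : ℕ}
    (p : IncPath w E s v e l) :
    ∃ (u : V) (q : G.Walk u v), q.IsPath ∧ q.edges.Pairwise (fun e f => w e < w f) ∧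
      q.length = l ∧ (∀ z, z ∈ q.support ↔ z ∈ s) ∧ ∀ f ∈ q.edges, w f ≤ w e := by
  induction p with
  | @single u v h hne =>
    have hadj : G.Adj u v := hE h
    exact ⟨u, .cons hadj .nil, by simp [hne], by simp, by simp, by simp, by simp⟩
  | @snoc s v z e l p h hz hlt ih =>
    obtain ⟨u, q, hpath, hinc, hlen, hsupp, hle⟩ := ih
    have hadj : G.Adj v z := hE h
    refine ⟨u, q.concat hadj, hpath.concat (fun hc => hz ((hsupp z).1 hc)) hadj, ?_, ?_, ?_, ?_⟩
    · rw [SimpleGraph.Walk.edges_concat, List.concat_eq_append, List.pairwise_append]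
      refine ⟨hinc, List.pairwise_singleton _ _, fun f hf g hg => ?_⟩
      rw [List.mem_singleton.1 hg]
      exact (hle f hf).trans_lt hlt
    · rw [SimpleGraph.Walk.length_concat, hlen]
    · intro y
      simp [SimpleGraph.Walk.support_concat, hsupp, or_comm]
    · intro f hf
      rw [SimpleGraph.Walk.edges_concat, List.concat_eq_append, List.mem_append] at hf
      rcases hf with hf | hf
      · exact (hle f hf).trans hlt.le
      · rw [List.mem_singleton.1 hf]

theorem four_mul_sq_le_altitude_top {n L q : ℕ} (hL : n < 2 ^ L) (hq : 4 ≤ q) (hLq : L ≤ q)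
    (hn : 64 * q ^ 3 * L * n < n.choose 2) :
    4 * q ^ 2 ≤ (⊤ : SimpleGraph (Fin n)).altitude := by
  have : Nonempty (Fin n) := by
    rcases n with _ | n
    · simp at hn
    · infer_instance
  refine (SimpleGraph.altitude_isGreatest _).2 fun o => ?_
  have hsub : (↑(⊤ : SimpleGraph (Fin n)).edgeFinset : Set (Sym2 (Fin n))) ⊆
    (⊤ : SimpleGraph (Fin n)).edgeSet := by simp
  obtain ⟨w, hw, hwo⟩ := exists_edgeWeight o
  obtain ⟨s, x, e, p⟩ := exists_incPath_of_card_lt (w := w)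
    (E := (⊤ : SimpleGraph (Fin n)).edgeFinset) (hw.mono hsub)
    (fun e he => SimpleGraph.not_isDiag_of_mem_edgeFinset he) (L := L) (q := q) (by simpa using hL)
    hq hLq (by rw [SimpleGraph.card_edgeFinset_top_eq_card_choose_two, Fintype.card_fin]; exact hn)
  obtain ⟨u, p', h1, h2, h3, -⟩ := p.exists_walk hsub
  refine ⟨u, x, p', h1, h2.imp_of_mem fun {f g} hf hg hlt => ?_, h3⟩
  exact ⟨p'.edges_subset_edgeSet hf, p'.edges_subset_edgeSet hg, hwo f g _ _ hlt⟩

end Altitude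

/-! ### Choice of `q` and asymptotics -/

section Asymptotics

theorem eventually_const_le_logb (c : ℝ) : ∀ᶠ n : ℕ in atTop, c ≤ Real.logb 2 n :=
  ((Real.tendsto_logb_atTop one_lt_two).comp tendsto_natCast_atTop_atTop).eventually_ge_atTop c

theorem eventually_logb_pow_le {C : ℝ} (hC : 0 < C) :
    ∀ᶠ n : ℕ in atTop, C * Real.logb 2 n ^ 4 ≤ n := by
  have hlog : 0 < Real.log 2 := Real.log_pos one_lt_two
  have h := ((Real.isLittleO_pow_log_id_atTop (n := 4)).comp_tendsto
    tendsto_natCast_atTop_atTop).bound (show 0 < Real.log 2 ^ 4 / C by positivity)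
  filter_upwards [h] with n hn
  simp only [Function.comp_apply, id_eq, Real.norm_eq_abs, Nat.abs_cast,
    abs_of_nonneg (show 0 ≤ Real.log (n : ℝ) ^ 4 by positivity)] at hn
  rw [Real.logb, div_pow, ← mul_div_assoc, div_le_iff₀ (by positivity)]
  calc C * Real.log n ^ 4 ≤ C * (Real.log 2 ^ 4 / C * n) := by gcongr
    _ = n * Real.log 2 ^ 4 := by field_simp

theorem eventually_le_altitude_top : ∀ᶠ n : ℕ in atTop,
    1 / 20 * ((n : ℝ) / Real.logb 2 (n : ℝ)) ^ (2 / 3 : ℝ) ≤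
      ((⊤ : SimpleGraph (Fin n)).altitude : ℝ) := by
  filter_upwards [eventually_const_le_logb 5, eventually_logb_pow_le (C := 4096) (by norm_num),
    eventually_ge_atTop 3] with n hlg hn hn3
  set g := Real.logb 2 (n : ℝ) with hg
  have hn3' : (3 : ℝ) ≤ n := by exact_mod_cast hn3
  have hg0 : 0 < g := by linarith
  set t : ℝ := ((n : ℝ) / g) ^ (1 / 3 : ℝ) with ht
  have ht0 : 0 ≤ t := by positivity
  have ht3 : t ^ 3 = n / g := by
    rw [ht, ← Real.rpow_natCast, ← Real.rpow_mul (by positivity)]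
    norm_num
  have ht2 : ((n : ℝ) / g) ^ (2 / 3 : ℝ) = t ^ 2 := by
    rw [ht, ← Real.rpow_natCast, ← Real.rpow_mul (by positivity)]
    norm_num
  have htg : 16 * g ≤ t := by
    refine le_of_pow_le_pow_left₀ (n := 3) (by norm_num) ht0 ?_
    rw [ht3, le_div_iff₀ hg0]
    linarith [show (16 * g) ^ 3 * g = 4096 * g ^ 4 by ring]
  have hqle : ((⌊t / 8⌋₊ : ℕ) : ℝ) ≤ t / 8 := Nat.floor_le (by positivity)
  have hqge : t / 8 - 1 < ((⌊t / 8⌋₊ : ℕ) : ℝ) := Nat.sub_one_lt_floor _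
  -- The divisor `8` makes `64 * q ^ 3 * L * n ≤ n ^ 2 / 4`, as `L ≤ 2 * g`; then `4 * q ^ 2` is
  -- about `t ^ 2 / 16`, and the slack over `t ^ 2 / 20` absorbs the rounding once `80 ≤ t`.
  set q := ⌊t / 8⌋₊ with hq
  set L := Nat.log 2 n + 1 with hLdef
  have hLg : (L : ℝ) ≤ g + 1 := by
    have : (Nat.log 2 n : ℝ) ≤ g := by
      simpa [hg] using Real.natLog_le_logb n 2
    rw [hLdef]
    push_cast
    linarith
  have hkey : 4 * q ^ 2 ≤ (⊤ : SimpleGraph (Fin n)).altitude := by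
    refine four_mul_sq_le_altitude_top (L := L) (Nat.lt_pow_succ_log_self (by norm_num) n) ?_ ?_ ?_
    · have : (4 : ℝ) ≤ q := by linarith
      exact_mod_cast this
    · have : (L : ℝ) ≤ q := by linarith
      exact_mod_cast this
    · have hq3 : (q : ℝ) ^ 3 ≤ n / g / 512 := by
        calc (q : ℝ) ^ 3 ≤ (t / 8) ^ 3 := by gcongr
          _ = n / g / 512 := by rw [div_pow, ht3]; norm_num
      have hqL : (q : ℝ) ^ 3 * L ≤ n / 256 := by
        calc (q : ℝ) ^ 3 * L ≤ n / g / 512 * (2 * g) := by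
              gcongr
              linarith
          _ = n / 256 := by field_simp; norm_num
      have : ((64 * q ^ 3 * L * n : ℕ) : ℝ) < (n.choose 2 : ℕ) := by
        rw [Nat.cast_choose_two]
        push_cast
        calc 64 * (q : ℝ) ^ 3 * L * n = 64 * ((q : ℝ) ^ 3 * L) * n := by ring
          _ ≤ 64 * ((n : ℝ) / 256) * n := by gcongr
          _ < (n : ℝ) * (n - 1) / 2 := by nlinarith
      exact_mod_cast this
  rw [ht2]
  have h80 : 80 ≤ t := by linarith
  calc 1 / 20 * t ^ 2 ≤ 4 * (t / 8 - 1) ^ 2 := by nlinarith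
    _ ≤ 4 * (q : ℝ) ^ 2 := by
      have : 0 ≤ t / 8 - 1 := by linarith
      gcongr
    _ = ((4 * q ^ 2 : ℕ) : ℝ) := by push_cast; ring
    _ ≤ _ := by exact_mod_cast hkey

end Asymptotics

theorem mainTheorem1 :
    ∃ ε : ℕ → ℝ, Tendsto ε atTop (𝓝 0) ∧
      ∀ n : ℕ, 2 ≤ n →
        (1 / 20 - ε n) * ((n : ℝ) / Real.logb 2 (n : ℝ)) ^ (2 / 3 : ℝ) ≤
          ((⊤ : SimpleGraph (Fin n)).altitude : ℝ) := by
  obtain ⟨N, hN⟩ := eventually_atTop.1 eventually_le_altitude_top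
  -- The value `1 / 20` makes the bound trivial for small `n`.
  refine ⟨fun n => if N ≤ n then 0 else 1 / 20, ?_, fun n _ => ?_⟩
  · refine tendsto_const_nhds.congr' ?_
    filter_upwards [eventually_ge_atTop N] with n hn
    simp [hn]
  · by_cases hn : N ≤ n
    · simpa [hn] using hN n hn
    · simp [hn]
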